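/- All graphs are finite and simple. For a graph $G$, a set $D \subseteq V(G)$ is dominating if every vertex of $G$ is in $D$ or adjacent to a vertex of $D$; it is a minimal dominating set if moreover no proper subset of $D$ is dominating. The upper domination number $\Gamma(G)$ is the maximum size of a minimal dominating set of $G$. The direct product $G \times H$ is the graph on $V(G) \times V(H)$ in which $(u,u')$ and $(v,v')$ are adjacent if and only if $uv \in E(G)$ and $u'v' \in E(H)$. The Cartesian product $G \mathbin{\square} H$ is the graph on $V(G) \times V(H)$ in which $(u,u')$ and $(v,v')$ are adjacent if and only if either $u = v$ and $u'v' \in E(H)$, or $uv \in E(G)$ and $u' = v'$. Theorem. Let $n \ge 71$ and let $G_n = K_2 \mathbin{\square} K_n$ be the $2 \times n$ rook graph. Then $$\Gamma(G_n \times G_n) = n^2 = \Gamma(G_n)^2 .$$ That is, equality is attained in the inequality $\Gamma(G \times H) \ge \Gamma(G)\,\Gamma(H)$ for $G = H = G_n$. -/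

import Mathlib

namespace UpperDomination

/-- The direct product `G × H`: `(u, u')` and `(v, v')` are adjacent if and only if `u, v` are
adjacent in `G` and `u', v'` are adjacent in `H`. -/
def directProd {V W : Type*} (G : SimpleGraph V) (H : SimpleGraph W) : SimpleGraph (V × W) where
  Adj x y := G.Adj x.1 y.1 ∧ H.Adj x.2 y.2
  symm := ⟨fun _ _ h => ⟨h.1.symm, h.2.symm⟩⟩
  loopless := ⟨fun _ h => G.loopless.irrefl _ h.1⟩

/-- `D` is dominating: every vertex is in `D` or adjacent to a vertex of `D`. -/
def IsDominating {V : Type*} (G : SimpleGraph V) (D : Set V) : Prop :=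
  ∀ v : V, v ∈ D ∨ ∃ u ∈ D, G.Adj u v

/-- `D` is a minimal dominating set: it is dominating and no proper subset of it is. -/
def IsMinimalDominating {V : Type*} (G : SimpleGraph V) (D : Set V) : Prop :=
  IsDominating G D ∧ ∀ D' : Set V, D' ⊂ D → ¬ IsDominating G D'

/-- The upper domination number `Γ(G)` of a finite graph: the maximum size of a minimal
dominating set. -/
noncomputable def upperDominationNumber {V : Type*} [Finite V] (G : SimpleGraph V) : ℕ :=
  sSup {k : ℕ | ∃ D : Set V, IsMinimalDominating G D ∧ D.ncard = k}

/-- The supremum in the definition of `Γ(G)` is a genuine maximum. -/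
theorem isGreatest_upperDominationNumber {V : Type*} [Finite V] (G : SimpleGraph V) :
    IsGreatest {k : ℕ | ∃ D : Set V, IsMinimalDominating G D ∧ D.ncard = k}
      (upperDominationNumber G) := by
  have hb : BddAbove {k : ℕ | ∃ D : Set V, IsMinimalDominating G D ∧ D.ncard = k} := by
    refine ⟨Nat.card V, ?_⟩
    rintro k ⟨D, -, rfl⟩
    exact Set.ncard_le_card D
  have hne : {k : ℕ | ∃ D : Set V, IsMinimalDominating G D ∧ D.ncard = k}.Nonempty := by
    have huniv : IsDominating G Set.univ := fun v => Or.inl (Set.mem_univ v)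
    obtain ⟨D, hD⟩ := (Set.toFinite {D : Set V | IsDominating G D}).exists_minimal ⟨_, huniv⟩
    exact ⟨D.ncard, D, ⟨hD.prop, fun D' hlt h => hD.not_lt h hlt⟩, rfl⟩
  exact ⟨Nat.sSup_mem hne hb, fun k hk => le_csSup hb hk⟩

/-- The `2 × n` rook graph `G_n = K_2 □ K_n`. -/
def rookGraph (n : ℕ) : SimpleGraph (Fin 2 × Fin n) :=
  SimpleGraph.boxProd (SimpleGraph.completeGraph (Fin 2)) (SimpleGraph.completeGraph (Fin n))

end UpperDomination

/-!
The vertex set of `G_n × G_n` is the union of four copies of the `n × n` grid, the quadrants, indexed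
by the two `K_2`-coordinates `(a, b) ∈ {0, 1}²`. Vertices of the same quadrant are adjacent when they
share neither row nor column; flipping `a` joins a cell to the other cells of its row, flipping `b` to the other cells of
its column, and flipping both joins it to the same cell.

Every element `v` of a minimal dominating set `D` has a private vertex: some `w` whose closed
neighbourhood meets `D` in `v` only. Let `A`, `B`, `B'`, `C` be the parts of `D` in the quadrant
of `v`, in those with `a` resp. `b` flipped, and in the opposite one. The private vertex of
`v ∈ A` may lie in any of the four quadrants, and

* in the quadrant of `v`, it forces `#A ≤ 2n + 1`;
* in the quadrant of `B`, it forces the row of `v` to hold at most two elements of `A` and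
  `#B ≤ 2n`; symmetrically for columns and `B'`;
* in the opposite quadrant, it is the cell of `v` itself, and `C` lies in the cross (row and column)
  of `v`, while `B` misses the rest of the column and `B'` the rest of the row of `v`.

All but `O(n)` elements of `A` are thus of the last kind (`HasPrivate.card_le`), and if there are
more than `2n` of these, then `C = ∅` (`card_oppPart_le`). Let `#D > n²` and
let `A` be the largest part; then `C = ∅`. When only the last kind and the column kind occur in `A`, the sets `A` and
`B` together have at most `n` elements in each column (`card_add_card_le_sq`). This settles the
case `#B > 4n`, where `B' = ∅`, and by transposition the case `#B' > 4n`.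

Otherwise `#A > n² - 8n`. Call a column sparse if it has at most one element of the last kind, and
likewise for rows. There are `y ≤ 9` sparse columns and `z ≤ 9` sparse rows; they contain all of `B`
and all of `B'` respectively. If `z = 0` or `y = 0`, the column bound or its transpose applies.
If both are positive, `#A` loses about `n (y + z)`, whereas `B` and `B'` cannot regain both terms:
either `B` has at most `y` elements of the last kind, or `#B' ≤ z`
(`card_oppPart_le_or_card_le`).

The value `n²` is attained by a full quadrant, each of whose elements has its private vertex in the
opposite quadrant.
-/

namespace UpperDomination

open Finset

/-! ### Private vertices of the elements of a quadrant -/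

section Quadrants

variable {n : ℕ}

/-- `v ∈ A` has a private vertex `w` in its own quadrant. Here and below `A` is the part of the
dominating set in the quadrant of `v`, `B` and `B'` are the parts in the quadrants with the first
resp. second `K_2`-coordinate flipped, and `C` is the part in the opposite quadrant. -/
def IsOwnPrivate (A B B' C : Finset (Fin n × Fin n)) (v : Fin n × Fin n) : Prop :=
  ∃ w, (v = w ∨ v.1 ≠ w.1 ∧ v.2 ≠ w.2) ∧
    (∀ p ∈ A, p ≠ v → p ≠ w ∧ (p.1 = w.1 ∨ p.2 = w.2)) ∧
    (∀ p ∈ B, p.1 = w.1 → p = w) ∧ (∀ p ∈ B', p.2 = w.2 → p = w) ∧ w ∉ C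

/-- `v ∈ A` has a private vertex `w` in the quadrant of `B`; such a `w` lies in the row of `v`. -/
def IsRowPrivate (A B B' C : Finset (Fin n × Fin n)) (v : Fin n × Fin n) : Prop :=
  ∃ w, v.1 = w.1 ∧ v.2 ≠ w.2 ∧ (∀ p ∈ A, p.1 = w.1 → p ≠ v → p = w) ∧
    (∀ p ∈ B, p ≠ w ∧ (p.1 = w.1 ∨ p.2 = w.2)) ∧ (∀ p ∈ C, p.2 = w.2 → p = w) ∧ w ∉ B'

/-- `v ∈ A` has a private vertex `w` in the quadrant of `B'`; such a `w` lies in the column of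
`v`. -/
def IsColPrivate (A B B' C : Finset (Fin n × Fin n)) (v : Fin n × Fin n) : Prop :=
  ∃ w, v.2 = w.2 ∧ v.1 ≠ w.1 ∧ (∀ p ∈ A, p.2 = w.2 → p ≠ v → p = w) ∧
    (∀ p ∈ B', p ≠ w ∧ (p.1 = w.1 ∨ p.2 = w.2)) ∧ (∀ p ∈ C, p.1 = w.1 → p = w) ∧ w ∉ B

/-- The cell of `v` in the opposite quadrant, which is the only neighbour of `v` there, is a private
vertex of `v`. -/
def IsOppPrivate (B B' C : Finset (Fin n × Fin n)) (v : Fin n × Fin n) : Prop :=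
  (∀ p ∈ C, p ≠ v ∧ (p.1 = v.1 ∨ p.2 = v.2)) ∧
    (∀ p ∈ B', p.1 = v.1 → p = v) ∧ (∀ p ∈ B, p.2 = v.2 → p = v)

/-- Every element of `A` has a private vertex in one of the four quadrants. -/
def HasPrivate (A B B' C : Finset (Fin n × Fin n)) : Prop :=
  ∀ v ∈ A, IsOwnPrivate A B B' C v ∨ IsRowPrivate A B B' C v ∨ IsColPrivate A B B' C v ∨
    IsOppPrivate B B' C v

/-- The image of a set of cells under interchanging rows and columns. As this also interchanges the
two factors of the product graph, it swaps the roles of `B` and `B'`. -/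
def transpose (A : Finset (Fin n × Fin n)) : Finset (Fin n × Fin n) :=
  A.map (Equiv.prodComm _ _).toEmbedding

@[simp] lemma mem_transpose {A : Finset (Fin n × Fin n)} {v : Fin n × Fin n} :
    v ∈ transpose A ↔ v.swap ∈ A := by
  simp [transpose]

@[simp] lemma card_transpose (A : Finset (Fin n × Fin n)) : #(transpose A) = #A := by
  simp [transpose]

@[simp] lemma transpose_transpose (A : Finset (Fin n × Fin n)) :
    transpose (transpose A) = A := by
  ext v
  simp

@[simp] lemma transpose_empty : transpose (∅ : Finset (Fin n × Fin n)) = ∅ := by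
  simp [transpose]

lemma IsColPrivate.transpose {A B B' C : Finset (Fin n × Fin n)} {v : Fin n × Fin n}
    (h : IsColPrivate A B B' C v) :
    IsRowPrivate (transpose A) (transpose B') (transpose B) (transpose C) v.swap := by
  obtain ⟨w, h1, h2, h3, h4, h5, h6⟩ := h
  refine ⟨w.swap, h1, h2, ?_, ?_, ?_, ?_⟩
  all_goals
    simp only [mem_transpose, Prod.forall, Prod.ext_iff, Prod.fst_swap, Prod.snd_swap,
      Prod.swap_prod_mk, ne_eq] at *
    grind

lemma IsRowPrivate.transpose {A B B' C : Finset (Fin n × Fin n)} {v : Fin n × Fin n}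
    (h : IsRowPrivate A B B' C v) :
    IsColPrivate (transpose A) (transpose B') (transpose B) (transpose C) v.swap := by
  obtain ⟨w, h1, h2, h3, h4, h5, h6⟩ := h
  refine ⟨w.swap, h1, h2, ?_, ?_, ?_, ?_⟩
  all_goals
    simp only [mem_transpose, Prod.forall, Prod.ext_iff, Prod.fst_swap, Prod.snd_swap,
      Prod.swap_prod_mk, ne_eq] at *
    grind

lemma IsOppPrivate.transpose {B B' C : Finset (Fin n × Fin n)} {v : Fin n × Fin n}
    (h : IsOppPrivate B B' C v) :
    IsOppPrivate (transpose B') (transpose B) (transpose C) v.swap := by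
  obtain ⟨h1, h2, h3⟩ := h
  refine ⟨?_, ?_, ?_⟩
  all_goals
    simp only [mem_transpose, Prod.forall, Prod.ext_iff, Prod.fst_swap, Prod.snd_swap,
      Prod.swap_prod_mk, ne_eq] at *
    grind

lemma IsOwnPrivate.transpose {A B B' C : Finset (Fin n × Fin n)} {v : Fin n × Fin n}
    (h : IsOwnPrivate A B B' C v) :
    IsOwnPrivate (transpose A) (transpose B') (transpose B) (transpose C) v.swap := by
  obtain ⟨w, h1, h2, h3, h4, h5⟩ := h
  refine ⟨w.swap, ?_, ?_, ?_, ?_, ?_⟩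
  all_goals
    simp only [mem_transpose, Prod.forall, Prod.ext_iff, Prod.fst_swap, Prod.snd_swap,
      Prod.swap_prod_mk, ne_eq] at *
    grind

lemma HasPrivate.transpose {A B B' C : Finset (Fin n × Fin n)} (h : HasPrivate A B B' C) :
    HasPrivate (transpose A) (transpose B') (transpose B) (transpose C) := by
  intro v hv
  rcases h _ (mem_transpose.1 hv) with h | h | h | h
  · exact .inl h.transpose
  · exact .inr (.inr (.inl h.transpose))
  · exact .inr (.inl h.transpose)
  · exact .inr (.inr (.inr h.transpose))

/-! ### Counting in crosses, rows and columns -/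

lemma card_row_le (A : Finset (Fin n × Fin n)) (i : Fin n) : #{p ∈ A | p.1 = i} ≤ n := by
  calc #{p ∈ A | p.1 = i} ≤ #(univ : Finset (Fin n)) :=
        card_le_card_of_injOn Prod.snd (by simp) (by
          intro p hp q hq h
          simp only [coe_filter, Set.mem_ofPred_eq] at hp hq
          exact Prod.ext (hp.2.trans hq.2.symm) h)
    _ = n := by simp

lemma card_col_le (A : Finset (Fin n × Fin n)) (j : Fin n) : #{p ∈ A | p.2 = j} ≤ n := by
  calc #{p ∈ A | p.2 = j} ≤ #(univ : Finset (Fin n)) :=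
        card_le_card_of_injOn Prod.fst (by simp) (by
          intro p hp q hq h
          simp only [coe_filter, Set.mem_ofPred_eq] at hp hq
          exact Prod.ext h (hp.2.trans hq.2.symm))
    _ = n := by simp

lemma card_le_of_forall_col {A : Finset (Fin n × Fin n)} {Y : Finset (Fin n)} {k : ℕ}
    (hY : ∀ p ∈ A, p.2 ∈ Y) (hk : ∀ j ∈ Y, #{p ∈ A | p.2 = j} ≤ k) : #A ≤ #Y * k := by
  rw [card_eq_sum_card_fiberwise (f := Prod.snd) (t := Y) hY]
  exact sum_le_card_nsmul _ _ _ hk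

lemma card_le_of_forall_row {A : Finset (Fin n × Fin n)} {Z : Finset (Fin n)} {k : ℕ}
    (hZ : ∀ p ∈ A, p.1 ∈ Z) (hk : ∀ i ∈ Z, #{p ∈ A | p.1 = i} ≤ k) : #A ≤ #Z * k := by
  rw [card_eq_sum_card_fiberwise (f := Prod.fst) (t := Z) hZ]
  exact sum_le_card_nsmul _ _ _ hk

lemma card_le_of_subset_cross {A : Finset (Fin n × Fin n)} (w : Fin n × Fin n)
    (h : ∀ p ∈ A, p.1 = w.1 ∨ p.2 = w.2) : #A ≤ 2 * n := by
  have h1 : A ⊆ {p ∈ A | p.1 = w.1} ∪ {p ∈ A | p.2 = w.2} := by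
    intro p hp
    simpa [hp] using h p hp
  have h2 := (card_le_card h1).trans (card_union_le _ _)
  have h3 := card_row_le A w.1
  have h4 := card_col_le A w.2
  omega

lemma IsOwnPrivate.card_le {A B B' C : Finset (Fin n × Fin n)} {v : Fin n × Fin n}
    (h : IsOwnPrivate A B B' C v) : #A ≤ 2 * n + 1 := by
  obtain ⟨w, -, h, -⟩ := h
  have h1 : #(A.erase v) ≤ 2 * n :=
    card_le_of_subset_cross w fun p hp => (h p (mem_of_mem_erase hp) (ne_of_mem_erase hp)).2
  have := A.pred_card_le_card_erase (a := v)
  omega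

lemma IsRowPrivate.card_le {A B B' C : Finset (Fin n × Fin n)} {v : Fin n × Fin n}
    (h : IsRowPrivate A B B' C v) : #B ≤ 2 * n := by
  obtain ⟨w, -, -, -, h, -⟩ := h
  exact card_le_of_subset_cross w fun p hp => (h p hp).2

lemma IsColPrivate.card_le {A B B' C : Finset (Fin n × Fin n)} {v : Fin n × Fin n}
    (h : IsColPrivate A B B' C v) : #B' ≤ 2 * n := by
  obtain ⟨w, -, -, -, h, -⟩ := h
  exact card_le_of_subset_cross w fun p hp => (h p hp).2

lemma IsRowPrivate.card_row_le_two {A B B' C : Finset (Fin n × Fin n)} {v : Fin n × Fin n}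
    (h : IsRowPrivate A B B' C v) : #{p ∈ A | p.1 = v.1} ≤ 2 := by
  obtain ⟨w, hvw, -, h, -⟩ := h
  have : ({p ∈ A | p.1 = v.1} : Finset _) ⊆ {v, w} := by
    intro p hp
    simp only [mem_filter] at hp
    have := h p hp.1 (hp.2.trans hvw)
    simp only [mem_insert, mem_singleton]
    tauto
  exact (card_le_card this).trans card_le_two

lemma IsColPrivate.card_col_le_two {A B B' C : Finset (Fin n × Fin n)} {v : Fin n × Fin n}
    (h : IsColPrivate A B B' C v) : #{p ∈ A | p.2 = v.2} ≤ 2 := by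
  obtain ⟨w, hvw, -, h, -⟩ := h
  have : ({p ∈ A | p.2 = v.2} : Finset _) ⊆ {v, w} := by
    intro p hp
    simp only [mem_filter] at hp
    have := h p hp.1 (hp.2.trans hvw)
    simp only [mem_insert, mem_singleton]
    tauto
  exact (card_le_card this).trans card_le_two

open Classical in
/-- The elements of `A` with a private vertex in the opposite quadrant. -/
noncomputable def oppPart (A B B' C : Finset (Fin n × Fin n)) : Finset (Fin n × Fin n) :=
  {v ∈ A | IsOppPrivate B B' C v}

lemma mem_oppPart {A B B' C : Finset (Fin n × Fin n)} {v : Fin n × Fin n} :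
    v ∈ oppPart A B B' C ↔ v ∈ A ∧ IsOppPrivate B B' C v := by
  simp [oppPart]

lemma oppPart_subset (A B B' C : Finset (Fin n × Fin n)) : oppPart A B B' C ⊆ A :=
  fun _ hv => (mem_oppPart.1 hv).1

lemma oppPart_transpose (A B B' C : Finset (Fin n × Fin n)) :
    oppPart (transpose A) (transpose B') (transpose B) (transpose C) =
      transpose (oppPart A B B' C) := by
  ext v
  rw [mem_oppPart, mem_transpose, mem_transpose, mem_oppPart]
  refine and_congr_right fun _ => ⟨fun h => ?_, fun h => h.transpose⟩
  simpa using h.transpose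

/-- An element of `C` lies in the cross of every element of `oppPart A B B' C`, hence the latter is
contained in the cross of the former. -/
lemma card_oppPart_le {A B B' C : Finset (Fin n × Fin n)} (hC : C.Nonempty) :
    #(oppPart A B B' C) ≤ 2 * n := by
  obtain ⟨q, hq⟩ := hC
  refine card_le_of_subset_cross q fun p hp => ?_
  have := ((mem_oppPart.1 hp).2.1 q hq).2
  exact this.imp Eq.symm Eq.symm

lemma card_col_le_two_total (A : Finset (Fin n × Fin n)) :
    #{v ∈ A | #{p ∈ A | p.2 = v.2} ≤ 2} ≤ n * 2 := by
  have := card_le_of_forall_col (A := {v ∈ A | #{p ∈ A | p.2 = v.2} ≤ 2}) (Y := univ) (k := 2)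
    (by simp) (by
      intro j _
      by_cases hj : #{p ∈ A | p.2 = j} ≤ 2
      · exact (card_le_card (filter_subset_filter _ (filter_subset _ _))).trans hj
      · rw [filter_filter, filter_eq_empty_iff.2]
        · simp
        · rintro p hp ⟨h1, rfl⟩
          exact hj h1)
  simpa using this

lemma card_row_le_two_total (A : Finset (Fin n × Fin n)) :
    #{v ∈ A | #{p ∈ A | p.1 = v.1} ≤ 2} ≤ n * 2 := by
  have := card_le_of_forall_row (A := {v ∈ A | #{p ∈ A | p.1 = v.1} ≤ 2}) (Z := univ) (k := 2)
    (by simp) (by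
      intro j _
      by_cases hj : #{p ∈ A | p.1 = j} ≤ 2
      · exact (card_le_card (filter_subset_filter _ (filter_subset _ _))).trans hj
      · rw [filter_filter, filter_eq_empty_iff.2]
        · simp
        · rintro p hp ⟨h1, rfl⟩
          exact hj h1)
  simpa using this

/-- All but `O(n)` elements of a quadrant have their private vertex in the opposite one. -/
lemma HasPrivate.card_le {A B B' C : Finset (Fin n × Fin n)} (hn : 1 ≤ n)
    (h : HasPrivate A B B' C) : #A ≤ #(oppPart A B B' C) + 4 * n := by
  by_cases hown : ∃ v ∈ A, IsOwnPrivate A B B' C v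
  · obtain ⟨v, -, hv⟩ := hown
    have := hv.card_le
    omega
  · push Not at hown
    have hsub : A ⊆ oppPart A B B' C ∪ ({v ∈ A | #{p ∈ A | p.2 = v.2} ≤ 2} ∪
        {v ∈ A | #{p ∈ A | p.1 = v.1} ≤ 2}) := by
      intro v hv
      simp only [mem_union, mem_filter, mem_oppPart]
      rcases h v hv with h | h | h | h
      · exact absurd h (hown v hv)
      · exact .inr (.inr ⟨hv, h.card_row_le_two⟩)
      · exact .inr (.inl ⟨hv, h.card_col_le_two⟩)
      · exact .inl ⟨hv, h⟩
    have h1 := (card_le_card hsub).trans (card_union_le _ _)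
    have h2 := card_union_le {v ∈ A | #{p ∈ A | p.2 = v.2} ≤ 2} {v ∈ A | #{p ∈ A | p.1 = v.1} ≤ 2}
    have h3 := card_row_le_two_total A
    have h4 := card_col_le_two_total A
    omega

/-- For large `B` no element of `A` has its private vertex in the quadrant of `B`, and for nonempty
`C` few elements have theirs in the opposite quadrant. -/
lemma HasPrivate.card_le_of_card_lt {A B B' C : Finset (Fin n × Fin n)} (hn : 1 ≤ n)
    (h : HasPrivate A B B' C) (hB : 2 * n < #B) (hC : C.Nonempty) : #A ≤ 4 * n := by
  by_cases hown : ∃ v ∈ A, IsOwnPrivate A B B' C v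
  · obtain ⟨v, -, hv⟩ := hown
    have := hv.card_le
    omega
  · push Not at hown
    have hsub : A ⊆ oppPart A B B' C ∪ {v ∈ A | #{p ∈ A | p.2 = v.2} ≤ 2} := by
      intro v hv
      simp only [mem_union, mem_filter, mem_oppPart]
      rcases h v hv with h | h | h | h
      · exact absurd h (hown v hv)
      · exact absurd h.card_le (by omega)
      · exact .inr ⟨hv, h.card_col_le_two⟩
      · exact .inl ⟨hv, h⟩
    have h1 := (card_le_card hsub).trans (card_union_le _ _)
    have h3 := card_oppPart_le (A := A) (B := B) (B' := B') hC
    have h4 := card_col_le_two_total A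
    omega

/-- The column bound: if the private vertices of `A` lie in the quadrants of `B'` and `C` only, then
`A` and `B` together have at most `n` elements in each column. In a column all of whose elements of
`A` have private vertices in the quadrant of `B'`, these vertices are distinct and avoid the cells
of `B`. -/
lemma card_add_card_le_sq {A B B' C : Finset (Fin n × Fin n)} (hn : 3 ≤ n)
    (h : ∀ v ∈ A, IsColPrivate A B B' C v ∨ IsOppPrivate B B' C v) : #A + #B ≤ n ^ 2 := by
  have hcol : ∀ j : Fin n, #{p ∈ A | p.2 = j} + #{p ∈ B | p.2 = j} ≤ n := by
    intro j
    by_cases hopp : ∃ p ∈ A, p.2 = j ∧ IsOppPrivate B B' C p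
    · obtain ⟨p, hp, rfl, hpo⟩ := hopp
      have hB : ({q ∈ B | q.2 = p.2} : Finset _) ⊆ {p} := by
        intro q hq
        simp only [mem_filter] at hq
        simpa using hpo.2.2 q hq.1 hq.2
      have hB1 := card_le_card hB
      rw [card_singleton] at hB1
      by_cases hcol : ∃ q ∈ A, q.2 = p.2 ∧ IsColPrivate A B B' C q
      · obtain ⟨q, hq, hqp, hqc⟩ := hcol
        have := hqc.card_col_le_two
        rw [hqp] at this
        omega
      · push Not at hcol
        by_cases hp' : ∃ q ∈ A, q.2 = p.2 ∧ q ≠ p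
        · obtain ⟨q, hq, hqp, hne⟩ := hp'
          have hqo := (h q hq).resolve_left (hcol q hq hqp)
          have hB0 : ({q ∈ B | q.2 = p.2} : Finset _) = ∅ := by
            rw [filter_eq_empty_iff]
            intro r hr hrp
            exact hne ((hqo.2.2 r hr (hrp.trans hqp.symm)).symm.trans (hpo.2.2 r hr hrp))
          rw [hB0, card_empty]
          exact card_col_le A p.2
        · push Not at hp'
          have hA : ({q ∈ A | q.2 = p.2} : Finset _) ⊆ {p} := by
            intro q hq
            simp only [mem_filter] at hq
            simpa using hp' q hq.1 hq.2
          have hA1 := card_le_card hA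
          rw [card_singleton] at hA1
          omega
    · push Not at hopp
      -- `f` sends an element of `A` in column `j` to the cell of its private vertex.
      have hc : ∀ v : Fin n × Fin n, ∃ w : Fin n × Fin n, v ∈ A → v.2 = j → w.2 = j ∧ w ≠ v ∧
          w ∉ B ∧ (∀ p ∈ A, p.2 = j → p ≠ v → p = w) := by
        intro v
        by_cases hv : v ∈ A ∧ v.2 = j
        · obtain ⟨w, h1, h2, h3, -, -, h4⟩ :=
            (h v hv.1).resolve_right (hopp v hv.1 hv.2)
          refine ⟨w, fun _ _ => ⟨h1.symm.trans hv.2, fun e => h2 (by rw [e]), h4, ?_⟩⟩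
          intro p hp hpj
          exact h3 p hp (hpj.trans (hv.2.symm.trans h1))
        · exact ⟨v, fun h1 h2 => absurd ⟨h1, h2⟩ hv⟩
      choose f hf using hc
      have hinj : Set.InjOn f ({p ∈ A | p.2 = j} : Finset (Fin n × Fin n)) := by
        intro v hv w hw hvw
        simp only [coe_filter, Set.mem_ofPred_eq] at hv hw
        by_contra hne
        have h1 := (hf v hv.1 hv.2).2.2.2 w hw.1 hw.2 (Ne.symm hne)
        exact (hf w hw.1 hw.2).2.1 (hvw.symm.trans h1.symm)
      rw [← card_image_of_injOn hinj, ← card_union_of_disjoint]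
      · refine (card_le_card (t := {p ∈ univ | p.2 = j}) ?_).trans (card_col_le univ j)
        intro p hp
        simp only [mem_union, mem_image, mem_filter] at hp
        rcases hp with ⟨v, ⟨h1, h2⟩, rfl⟩ | hp
        · simpa using (hf v h1 h2).1
        · simpa using hp.2
      · rw [disjoint_left]
        intro p hp hpB
        simp only [mem_image, mem_filter] at hp hpB
        obtain ⟨v, ⟨h1, h2⟩, rfl⟩ := hp
        exact (hf v h1 h2).2.2.1 hpB.1
  rw [card_eq_sum_card_fiberwise (f := Prod.snd) (s := A) (t := univ) (by simp),
    card_eq_sum_card_fiberwise (f := Prod.snd) (s := B) (t := univ) (by simp), ← sum_add_distrib]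
  refine (sum_le_card_nsmul _ _ n fun j _ => hcol j).trans ?_
  simp [sq]

/-! ### Sparse rows and columns -/

/-- The rows with at most one element of `P`. -/
noncomputable def sparseRows (P : Finset (Fin n × Fin n)) : Finset (Fin n) :=
  {i | #{p ∈ P | p.1 = i} ≤ 1}

/-- The columns with at most one element of `P`. -/
noncomputable def sparseCols (P : Finset (Fin n × Fin n)) : Finset (Fin n) :=
  {j | #{p ∈ P | p.2 = j} ≤ 1}

lemma sparseRows_transpose (P : Finset (Fin n × Fin n)) :
    sparseRows (transpose P) = sparseCols P := by
  ext i
  simp only [sparseRows, sparseCols, transpose, filter_map, card_map, mem_filter, mem_univ,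
    true_and]
  rfl

lemma sparseCols_transpose (P : Finset (Fin n × Fin n)) :
    sparseCols (transpose P) = sparseRows P := by
  rw [← sparseRows_transpose, transpose_transpose]

lemma card_add_le_of_col_le {A : Finset (Fin n × Fin n)} {Y : Finset (Fin n)} {k : ℕ}
    (hk : ∀ j ∈ Y, #{p ∈ A | p.2 = j} ≤ k) : #A + #Y * n ≤ n ^ 2 + #Y * k := by
  have h1 : #{p ∈ A | p.2 ∈ Y} ≤ #Y * k := by
    refine card_le_of_forall_col (by simp) fun j hj => ?_
    exact (card_le_card (filter_subset_filter _ (filter_subset _ _))).trans (hk j hj)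
  have h2 : #{p ∈ A | p.2 ∉ Y} ≤ #Yᶜ * n :=
    card_le_of_forall_col (by simp) fun j _ => card_col_le _ j
  have h3 := card_filter_add_card_filter_not (s := A) (fun p => p.2 ∈ Y)
  have h4 : #Y + #Yᶜ = n := by simp [card_add_card_compl]
  nlinarith

/-- If `A` misses fewer than `l * n` cells and has few elements in each sparse column of `P`, then
there are few such columns. -/
lemma card_sparseCols_le {A P : Finset (Fin n × Fin n)} {k l : ℕ}
    (hk : ∀ j ∈ sparseCols P, #{p ∈ A | p.2 = j} ≤ k) (hA : n ^ 2 < #A + l * n)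
    (m : ℕ) (hm : l * n + (m + 1) * k ≤ (m + 1) * n) : #(sparseCols P) ≤ m := by
  have h1 := card_add_le_of_col_le hk
  by_contra! hlt
  obtain ⟨d, hd⟩ := Nat.exists_eq_add_of_le (Nat.succ_le_of_lt hlt)
  have hkn : k ≤ n := by
    by_contra! h
    nlinarith
  rw [hd] at h1
  nlinarith [Nat.mul_le_mul_left d hkn]

section Sparse

variable {A B B' C : Finset (Fin n × Fin n)}

lemma IsColPrivate.mem_sparseCols {v : Fin n × Fin n} (hv : v ∈ A) (h : IsColPrivate A B B' C v)
    (ho : ¬ IsOppPrivate B B' C v) : v.2 ∈ sparseCols (oppPart A B B' C) := by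
  simp only [sparseCols, mem_filter, mem_univ, true_and]
  have h2 := h.card_col_le_two
  have h3 : ({p ∈ oppPart A B B' C | p.2 = v.2} : Finset _) ⊆
      ({p ∈ A | p.2 = v.2} : Finset _).erase v := by
    intro p hp
    simp only [mem_filter, mem_oppPart, mem_erase] at hp ⊢
    refine ⟨?_, hp.1.1, hp.2⟩
    rintro rfl
    exact ho hp.1.2
  have h4 := card_le_card h3
  rw [card_erase_of_mem (by simp [hv])] at h4
  omega

lemma IsRowPrivate.mem_sparseRows {v : Fin n × Fin n} (hv : v ∈ A) (h : IsRowPrivate A B B' C v)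
    (ho : ¬ IsOppPrivate B B' C v) : v.1 ∈ sparseRows (oppPart A B B' C) := by
  rw [← sparseCols_transpose, ← oppPart_transpose]
  refine IsColPrivate.mem_sparseCols (v := v.swap) (by simpa using hv) h.transpose fun h' => ho ?_
  simpa using h'.transpose

/-- Two elements of `oppPart A B B' C` in the same column leave no room for `B` in that column. -/
lemma mem_sparseCols_of_mem {v : Fin n × Fin n} (hv : v ∈ B) :
    v.2 ∈ sparseCols (oppPart A B B' C) := by
  simp only [sparseCols, mem_filter, mem_univ, true_and]
  refine card_le_one.2 fun p hp q hq => ?_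
  simp only [mem_filter, mem_oppPart] at hp hq
  exact (hp.1.2.2.2 v hv hp.2.symm).symm.trans (hq.1.2.2.2 v hv hq.2.symm)

lemma mem_sparseRows_of_mem {v : Fin n × Fin n} (hv : v ∈ B') :
    v.1 ∈ sparseRows (oppPart A B B' C) := by
  simp only [sparseRows, mem_filter, mem_univ, true_and]
  refine card_le_one.2 fun p hp q hq => ?_
  simp only [mem_filter, mem_oppPart] at hp hq
  exact (hp.1.2.2.1 v hv hp.2.symm).symm.trans (hq.1.2.2.1 v hv hq.2.symm)

/-- A sparse column holds either a column-private element, and then at most two elements of `A`, or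
at most one element of `oppPart A B B' C` besides elements in sparse rows. -/
lemma card_col_le_of_mem_sparseCols (hA : ∀ v ∈ A, ¬ IsOwnPrivate A B B' C v)
    (h : HasPrivate A B B' C) {j : Fin n} (hj : j ∈ sparseCols (oppPart A B B' C)) :
    #{p ∈ A | p.2 = j} ≤ max 2 (1 + #(sparseRows (oppPart A B B' C))) := by
  by_cases hc : ∃ v ∈ A, v.2 = j ∧ IsColPrivate A B B' C v
  · obtain ⟨v, -, rfl, hv⟩ := hc
    exact hv.card_col_le_two.trans (le_max_left _ _)
  · push Not at hc
    refine le_trans ?_ (le_max_right _ _)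
    have hsub : ({p ∈ A | p.2 = j} : Finset _) ⊆ ({p ∈ oppPart A B B' C | p.2 = j} : Finset _) ∪
        (sparseRows (oppPart A B B' C)).image (fun i => (i, j)) := by
      intro p hp
      simp only [mem_filter, mem_union, mem_image] at hp ⊢
      obtain ⟨hp, rfl⟩ := hp
      by_cases ho : IsOppPrivate B B' C p
      · exact .inl ⟨mem_oppPart.2 ⟨hp, ho⟩, rfl⟩
      · rcases h p hp with h | h | h | h
        · exact absurd h (hA p hp)
        · exact .inr ⟨p.1, h.mem_sparseRows hp ho, rfl⟩
        · exact absurd h (hc p hp rfl)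
        · exact absurd h ho
    refine (card_le_card hsub).trans ((card_union_le _ _).trans (add_le_add ?_ card_image_le))
    simpa [sparseCols] using hj

lemma card_row_le_of_mem_sparseRows (hA : ∀ v ∈ A, ¬ IsOwnPrivate A B B' C v)
    (h : HasPrivate A B B' C) {i : Fin n} (hi : i ∈ sparseRows (oppPart A B B' C)) :
    #{p ∈ A | p.1 = i} ≤ max 2 (1 + #(sparseCols (oppPart A B B' C))) := by
  rw [← sparseCols_transpose, ← oppPart_transpose] at hi
  have := card_col_le_of_mem_sparseCols (A := transpose A) (fun v hv hv' => ?_) h.transpose hi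
  · rw [oppPart_transpose, sparseRows_transpose] at this
    refine le_trans (le_of_eq ?_) this
    simp only [transpose, filter_map, card_map]
    rfl
  · exact hA v.swap (by simpa using hv) (by simpa using hv'.transpose)

/-- The elements of `B` with a private vertex `w` in their own quadrant. Then `A` has at most one
element in the row of `w`, so this row is in `Z`. For a given row, those elements that lie in it
themselves are in the columns `Y`, and there are at most two others: each of three would have to lie
in the columns of the private vertices of the other two, but these columns are distinct. -/
lemma card_ownPrivate_le {Z Y : Finset (Fin n)} {S : Finset (Fin n × Fin n)}
    (hSB : S ⊆ B) (hS : ∀ v ∈ S, IsOwnPrivate B A C B' v) (hY : ∀ v ∈ B, v.2 ∈ Y)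
    (hZ : ∀ i, #{p ∈ A | p.1 = i} ≤ 1 → i ∈ Z) :
    #S ≤ #Z * (#Y + 2) := by
  classical
  have hw : ∀ v, ∃ w : Fin n × Fin n, v ∈ S → w.1 ∈ Z ∧ (v = w ∨ v.1 ≠ w.1 ∧ v.2 ≠ w.2) ∧
      ∀ p ∈ B, p ≠ v → p.1 = w.1 ∨ p.2 = w.2 := by
    intro v
    by_cases hv : v ∈ S
    · obtain ⟨w, h1, h2, h3, -⟩ := hS v hv
      refine ⟨w, fun _ => ⟨hZ _ ?_, h1, fun p hp hpv => (h2 p hp hpv).2⟩⟩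
      refine card_le_one.2 fun p hp q hq => ?_
      simp only [mem_filter] at hp hq
      exact (h3 p hp.1 hp.2).trans (h3 q hq.1 hq.2).symm
    · exact ⟨v, fun h => absurd h hv⟩
  choose f hf using hw
  -- `f v` is the cell of the private vertex of `v`.
  have hsplit : S ⊆ {v ∈ S | v.1 = (f v).1} ∪ {v ∈ S | v.1 ≠ (f v).1} := by
    intro v hv
    simp only [mem_union, mem_filter]
    tauto
  have h1 : #{v ∈ S | v.1 = (f v).1} ≤ #Z * #Y := by
    rw [← card_product]
    refine card_le_card fun v hv => ?_
    simp only [mem_filter, mem_product] at hv ⊢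
    exact ⟨hv.2 ▸ (hf v hv.1).1, hY v (hSB hv.1)⟩
  have h2 : #{v ∈ S | v.1 ≠ (f v).1} ≤ #Z * 2 := by
    rw [card_eq_sum_card_fiberwise (f := fun v => (f v).1) (t := Z)
      (fun v hv => (hf v (mem_filter.1 hv).1).1)]
    refine sum_le_card_nsmul _ _ _ fun i _ => ?_
    by_contra! h
    obtain ⟨u, v, w, hu, hv, hw, huv, huw, hvw⟩ := two_lt_card_iff.1 h
    simp only [mem_filter] at hu hv hw
    obtain ⟨⟨hu, hu1⟩, hui⟩ := hu
    obtain ⟨⟨hv, hv1⟩, hvi⟩ := hv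
    obtain ⟨⟨hw, hw1⟩, hwi⟩ := hw
    have hu2 := (hf u hu).2.1
    have hv2 := (hf v hv).2.1
    have hw2 := (hf w hw).2.1
    have a1 := (hf u hu).2.2 v (hSB hv) huv.symm
    have a2 := (hf u hu).2.2 w (hSB hw) huw.symm
    have a3 := (hf v hv).2.2 u (hSB hu) huv
    have a4 := (hf v hv).2.2 w (hSB hw) hvw.symm
    grind
  have := (card_le_card hsplit).trans (card_union_le _ _)
  nlinarith

lemma card_le_own_add_col {Z Y : Finset (Fin n)} (hB : HasPrivate B A C B') (hA : 2 * n < #A)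
    (hY : ∀ v ∈ B, v.2 ∈ Y) (hZ : ∀ i, #{p ∈ A | p.1 = i} ≤ 1 → i ∈ Z) :
    #B ≤ #Z * (#Y + 2) + #Y * 2 + #(oppPart B A C B') := by
  classical
  have hsub : B ⊆ {v ∈ B | IsOwnPrivate B A C B' v} ∪ {v ∈ B | #{p ∈ B | p.2 = v.2} ≤ 2} ∪
      oppPart B A C B' := by
    intro v hv
    simp only [mem_union, mem_filter, mem_oppPart]
    rcases hB v hv with h | h | h | h
    · exact .inl (.inl ⟨hv, h⟩)
    · exact absurd h.card_le (by omega)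
    · exact .inl (.inr ⟨hv, h.card_col_le_two⟩)
    · exact .inr ⟨hv, h⟩
  have h1 := (card_le_card hsub).trans (card_union_le _ _)
  have h2 := card_union_le {v ∈ B | IsOwnPrivate B A C B' v} {v ∈ B | #{p ∈ B | p.2 = v.2} ≤ 2}
  have h3 := card_ownPrivate_le (S := {v ∈ B | IsOwnPrivate B A C B' v}) (filter_subset _ _)
    (fun v hv => (mem_filter.1 hv).2) hY hZ
  have h4 : #{v ∈ B | #{p ∈ B | p.2 = v.2} ≤ 2} ≤ #Y * 2 := by
    refine card_le_of_forall_col (fun v hv => hY v (mem_filter.1 hv).1) fun j _ => ?_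
    by_cases hj : #{p ∈ B | p.2 = j} ≤ 2
    · exact (card_le_card (filter_subset_filter _ (filter_subset _ _))).trans hj
    · rw [filter_filter, filter_eq_empty_iff.2]
      · simp
      · rintro p hp ⟨h1, rfl⟩
        exact hj h1
  omega

/-- Two elements of `oppPart B A C B'` in the same column force `B'` into that column, as `B'` lies in
the crosses of both. -/
lemma card_oppPart_le_or_card_le {Z Y : Finset (Fin n)}
    (hY : ∀ v ∈ B, v.2 ∈ Y) (hZ : ∀ v ∈ B', v.1 ∈ Z) :
    #(oppPart B A C B') ≤ #Y ∨ #B' ≤ #Z := by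
  by_contra! h
  obtain ⟨p, hp, q, hq, hne, hpq⟩ := exists_ne_map_eq_of_card_lt_of_maps_to h.1
    (f := Prod.snd) (fun v hv => hY v (oppPart_subset _ _ _ _ hv))
  refine absurd h.2 (not_lt.2 ?_)
  refine card_le_card_of_injOn Prod.fst hZ fun u hu v hv huv => ?_
  have a1 := ((mem_oppPart.1 hp).2.1 u hu).2
  have a2 := ((mem_oppPart.1 hq).2.1 u hu).2
  have a3 := ((mem_oppPart.1 hp).2.1 v hv).2
  have a4 := ((mem_oppPart.1 hq).2.1 v hv).2
  obtain ⟨p1, p2⟩ := p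
  obtain ⟨q1, q2⟩ := q
  obtain ⟨u1, u2⟩ := u
  obtain ⟨v1, v2⟩ := v
  simp only [Prod.mk.injEq, ne_eq] at *
  grind

/-- Inclusion–exclusion for the cells in the columns `Y` and the rows `Z`. -/
lemma card_le_of_sparse {Z Y : Finset (Fin n)} {k l : ℕ}
    (hk : ∀ j ∈ Y, #{p ∈ A | p.2 = j} ≤ k) (hl : ∀ i ∈ Z, #{p ∈ A | p.1 = i} ≤ l) :
    #A + #Y * n + #Z * n ≤ n ^ 2 + #Y * #Z + #Y * k + #Z * l := by
  have h1 : #{p ∈ A | p.2 ∈ Y} ≤ #Y * k := by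
    refine card_le_of_forall_col (by simp) fun j hj => ?_
    exact (card_le_card (filter_subset_filter _ (filter_subset _ _))).trans (hk j hj)
  have h2 : #{p ∈ A | p.1 ∈ Z} ≤ #Z * l := by
    refine card_le_of_forall_row (by simp) fun j hj => ?_
    exact (card_le_card (filter_subset_filter _ (filter_subset _ _))).trans (hl j hj)
  have hsub : A ⊆ {p ∈ A | p.2 ∈ Y} ∪ {p ∈ A | p.1 ∈ Z} ∪ Zᶜ ×ˢ Yᶜ := by
    intro p hp
    simp only [mem_union, mem_filter, mem_product, mem_compl]
    tauto
  have h3 := (card_le_card hsub).trans (card_union_le _ _)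
  have h4 := card_union_le {p ∈ A | p.2 ∈ Y} {p ∈ A | p.1 ∈ Z}
  rw [card_product] at h3
  have h5 : #Y + #Yᶜ = n := by simp [card_add_card_compl]
  have h6 : #Z + #Zᶜ = n := by simp [card_add_card_compl]
  have h7 : #Zᶜ * #Yᶜ + #Y * n + #Z * n = n ^ 2 + #Y * #Z := by
    have e5 : (#Yᶜ : ℤ) = n - #Y := by omega
    have e6 : (#Zᶜ : ℤ) = n - #Z := by omega
    zify
    rw [e5, e6]
    ring
  omega

end Sparse

/-! ### The bound for four quadrants -/

/-- The elements of all four quadrants have private vertices. -/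
structure IsPrivateConfig (A B B' C : Finset (Fin n × Fin n)) : Prop where
  base : HasPrivate A B B' C
  flipFst : HasPrivate B A C B'
  flipSnd : HasPrivate B' C A B
  flipBoth : HasPrivate C B' B A

lemma IsPrivateConfig.transpose {A B B' C : Finset (Fin n × Fin n)}
    (h : IsPrivateConfig A B B' C) :
    IsPrivateConfig (transpose A) (transpose B') (transpose B) (transpose C) :=
  ⟨h.base.transpose, h.flipSnd.transpose, h.flipFst.transpose, h.flipBoth.transpose⟩

lemma IsPrivateConfig.card_le_of_lt {A B B' : Finset (Fin n × Fin n)} (hn : 3 ≤ n)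
    (h : IsPrivateConfig A B B' ∅) (hA : 2 * n + 1 < #A) (hB : 4 * n < #B) :
    #A + #B + #B' ≤ n ^ 2 := by
  have hB' : B' = ∅ := by
    by_contra hne
    have := h.flipFst.card_le_of_card_lt (by omega) (by omega) (nonempty_iff_ne_empty.2 hne)
    omega
  subst hB'
  have := card_add_card_le_sq (A := A) (B := B) (B' := ∅) (C := ∅) hn (fun v hv => by
    rcases h.base v hv with h | h | h | h
    · exact absurd h.card_le (by omega)
    · exact absurd h.card_le (by omega)
    · exact .inl h
    · exact .inr h)
  simpa using this

lemma IsPrivateConfig.card_le_of_sparseRows_eq_empty {A B B' : Finset (Fin n × Fin n)} (hn : 3 ≤ n)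
    (h : IsPrivateConfig A B B' ∅) (hA : 2 * n + 1 < #A)
    (hZ : sparseRows (oppPart A B B' ∅) = ∅) :
    #A + #B + #B' ≤ n ^ 2 := by
  have hB' : B' = ∅ := by
    rw [eq_empty_iff_forall_notMem]
    intro v hv
    have := mem_sparseRows_of_mem (A := A) (B := B) (C := ∅) hv
    simp [hZ] at this
  have := card_add_card_le_sq (A := A) (B := B) (B' := B') (C := ∅) hn (fun v hv => by
    by_cases ho : IsOppPrivate B B' ∅ v
    · exact .inr ho
    rcases h.base v hv with h | h | h | h
    · exact absurd h.card_le (by omega)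
    · have := h.mem_sparseRows hv ho
      simp [hZ] at this
    · exact .inl h
    · exact .inr h)
  simpa [hB'] using this

/-- A first estimate. At most `4n` elements of `A` are outside `oppPart A B B' ∅`, so this set misses
fewer than `12n` cells. -/
lemma IsPrivateConfig.card_sparseCols_le_twelve {A B B' : Finset (Fin n × Fin n)} (hn : 71 ≤ n)
    (h : IsPrivateConfig A B B' ∅) (hA : n ^ 2 < #A + 8 * n) :
    #(sparseCols (oppPart A B B' ∅)) ≤ 12 := by
  have h1 := h.base.card_le (by omega)
  refine UpperDomination.card_sparseCols_le (A := oppPart A B B' ∅) (k := 1) (l := 12) ?_ ?_ 12 ?_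
  · intro j hj
    simpa [sparseCols] using hj
  · omega
  · omega

lemma IsPrivateConfig.card_sparseRows_le_twelve {A B B' : Finset (Fin n × Fin n)} (hn : 71 ≤ n)
    (h : IsPrivateConfig A B B' ∅) (hA : n ^ 2 < #A + 8 * n) :
    #(sparseRows (oppPart A B B' ∅)) ≤ 12 := by
  have := h.transpose.card_sparseCols_le_twelve hn (by simpa using hA)
  rwa [← sparseCols_transpose, ← oppPart_transpose]

lemma not_isOwnPrivate_of_lt_card {A B B' C : Finset (Fin n × Fin n)}
    (hA : 2 * n + 1 < #A) : ∀ v ∈ A, ¬ IsOwnPrivate A B B' C v :=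
  fun _ _ h => absurd h.card_le (by omega)

/-- The improved estimate: with at most `12` sparse rows, `A` itself has at most `13` elements in each
sparse column. -/
lemma IsPrivateConfig.card_sparseCols_le_nine {A B B' : Finset (Fin n × Fin n)} (hn : 71 ≤ n)
    (h : IsPrivateConfig A B B' ∅) (hA : n ^ 2 < #A + 8 * n) :
    #(sparseCols (oppPart A B B' ∅)) ≤ 9 := by
  have h1 := h.card_sparseRows_le_twelve hn hA
  refine UpperDomination.card_sparseCols_le (A := A) (k := 13) (l := 8) ?_ hA 9 (by omega)
  intro j hj
  refine (card_col_le_of_mem_sparseCols (not_isOwnPrivate_of_lt_card ?_) h.base hj).trans (by omega)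
  nlinarith

lemma IsPrivateConfig.card_sparseRows_le_nine {A B B' : Finset (Fin n × Fin n)} (hn : 71 ≤ n)
    (h : IsPrivateConfig A B B' ∅) (hA : n ^ 2 < #A + 8 * n) :
    #(sparseRows (oppPart A B B' ∅)) ≤ 9 := by
  have := h.transpose.card_sparseCols_le_nine hn (by simpa using hA)
  rwa [← sparseCols_transpose, ← oppPart_transpose]

lemma IsPrivateConfig.card_le_of_sparse {A B B' : Finset (Fin n × Fin n)} (hn : 71 ≤ n)
    (h : IsPrivateConfig A B B' ∅) (hA : n ^ 2 < #A + 8 * n) :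
    #A + #B + #B' ≤ n ^ 2 := by
  have hA1 : 2 * n + 1 < #A := by nlinarith
  rcases eq_empty_or_nonempty (sparseRows (oppPart A B B' ∅)) with hZ | hZ
  · exact h.card_le_of_sparseRows_eq_empty (by omega) hA1 hZ
  rcases eq_empty_or_nonempty (sparseCols (oppPart A B B' ∅)) with hY | hYne
  · have := h.transpose.card_le_of_sparseRows_eq_empty (by omega) (by simpa using hA1)
      (by rw [← hY, ← sparseRows_transpose, ← oppPart_transpose, transpose_empty])
    simp only [card_transpose] at this
    omega
  have hz9 := h.card_sparseRows_le_nine hn hA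
  have hy9 := h.card_sparseCols_le_nine hn hA
  have hY : ∀ v ∈ B, v.2 ∈ sparseCols (oppPart A B B' ∅) := fun v hv => mem_sparseCols_of_mem hv
  have hZ' : ∀ v ∈ B', v.1 ∈ sparseRows (oppPart A B B' ∅) := fun v hv => mem_sparseRows_of_mem hv
  have h1 := UpperDomination.card_le_of_sparse (A := A)
    (fun j hj => card_col_le_of_mem_sparseCols (not_isOwnPrivate_of_lt_card hA1) h.base hj)
    (fun i hi => card_row_le_of_mem_sparseRows (not_isOwnPrivate_of_lt_card hA1) h.base hi)
  have h2 := card_le_own_add_col (Z := sparseRows (oppPart A B B' ∅)) h.flipFst (by omega) hY (by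
    intro i hi
    simp only [sparseRows, mem_filter, mem_univ, true_and]
    exact (card_le_card (filter_subset_filter _ (oppPart_subset _ _ _ _))).trans hi)
  have h3 := card_oppPart_le_or_card_le (A := A) (C := ∅) hY hZ'
  have h4 := card_le_of_forall_col hY fun j _ => card_col_le B j
  have h5 := card_le_of_forall_row hZ' fun i _ => card_row_le B' i
  have hz1 := hZ.card_pos
  have hy1 := hYne.card_pos
  generalize #(sparseRows (oppPart A B B' ∅)) = z at *
  generalize #(sparseCols (oppPart A B B' ∅)) = y at *
  rw [max_eq_right (by omega), max_eq_right (by omega)] at h1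
  -- The loss `n * y` resp. `n * z` of `A` outweighs all error terms because `y, z ≤ 9` and `n ≥ 71`.
  rcases h3 with h3 | h3
  · have e1 : z * y ≤ 9 * y := Nat.mul_le_mul_right _ hz9
    have e2 : 71 * y ≤ n * y := Nat.mul_le_mul_right _ hn
    nlinarith
  · have e1 : z * y ≤ z * 9 := Nat.mul_le_mul_left _ hy9
    have e2 : 71 * z ≤ n * z := Nat.mul_le_mul_right _ hn
    nlinarith

lemma IsPrivateConfig.card_le_of_max {A B B' C : Finset (Fin n × Fin n)} (hn : 71 ≤ n)
    (h : IsPrivateConfig A B B' C) (hB : #B ≤ #A) (hB' : #B' ≤ #A) (hC : #C ≤ #A) :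
    #A + #B + #B' + #C ≤ n ^ 2 := by
  by_contra! hlt
  have hA : 17 * n < #A := by nlinarith
  have hCe : C = ∅ := by
    by_contra hne
    have h1 := card_oppPart_le (A := A) (B := B) (B' := B') (nonempty_iff_ne_empty.2 hne)
    have h2 := h.base.card_le (by omega)
    omega
  subst hCe
  rw [card_empty] at hlt
  by_cases hB4 : 4 * n < #B
  · have := h.card_le_of_lt (by omega) (by omega) hB4
    omega
  by_cases hB4' : 4 * n < #B'
  · have := h.transpose.card_le_of_lt (by omega) (by simp; omega) (by simpa using hB4')
    simp only [card_transpose] at this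
    omega
  have := h.card_le_of_sparse hn (by omega)
  omega

theorem IsPrivateConfig.card_le {A B B' C : Finset (Fin n × Fin n)} (hn : 71 ≤ n)
    (h : IsPrivateConfig A B B' C) : #A + #B + #B' + #C ≤ n ^ 2 := by
  have h2 : IsPrivateConfig B A C B' := ⟨h.flipFst, h.base, h.flipBoth, h.flipSnd⟩
  have h3 : IsPrivateConfig B' C A B := ⟨h.flipSnd, h.flipBoth, h.base, h.flipFst⟩
  have h4 : IsPrivateConfig C B' B A := ⟨h.flipBoth, h.flipSnd, h.flipFst, h.base⟩
  have i1 := h.card_le_of_max hn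
  have i2 := h2.card_le_of_max hn
  have i3 := h3.card_le_of_max hn
  have i4 := h4.card_le_of_max hn
  omega


end Quadrants

/-! ### Minimal dominating sets and private vertices -/

lemma IsMinimalDominating.exists_private {V : Type*} {G : SimpleGraph V} {D : Set V}
    (h : IsMinimalDominating G D) {v : V} (hv : v ∈ D) :
    ∃ w, (v = w ∨ G.Adj v w) ∧ ∀ u ∈ D, u ≠ v → u ≠ w ∧ ¬ G.Adj u w := by
  have h1 := h.2 (D \ {v}) ⟨Set.sdiff_subset, fun hs => (hs hv).2 rfl⟩
  unfold IsDominating at h1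
  push Not at h1
  obtain ⟨w, hw, hw'⟩ := h1
  refine ⟨w, ?_, ?_⟩
  · rcases h.1 w with hwD | ⟨u, hu, huw⟩
    · exact .inl (by by_contra hne; exact hw ⟨hwD, Ne.symm hne⟩)
    · by_cases huv : u = v
      · exact .inr (huv ▸ huw)
      · exact absurd huw (hw' u ⟨hu, huv⟩)
  · intro u hu huv
    refine ⟨?_, hw' u ⟨hu, huv⟩⟩
    rintro rfl
    exact hw ⟨hu, huv⟩

lemma isMinimalDominating_of_exists_private {V : Type*} {G : SimpleGraph V} {D : Set V}
    (h : IsDominating G D)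
    (hp : ∀ v ∈ D, ∃ w, ∀ u ∈ D, u ≠ v → u ≠ w ∧ ¬ G.Adj u w) : IsMinimalDominating G D := by
  refine ⟨h, fun D' hD' hdom => ?_⟩
  obtain ⟨v, hv, hv'⟩ := Set.exists_of_ssubset hD'
  obtain ⟨w, hw⟩ := hp v hv
  have hne : ∀ u ∈ D', u ≠ v := fun u hu e => hv' (e ▸ hu)
  rcases hdom w with hwD | ⟨u, hu, huw⟩
  · exact (hw w (hD'.1 hwD) (hne w hwD)).1 rfl
  · exact (hw u (hD'.1 hu) (hne u hu)).2 huw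

lemma upperDominationNumber_eq {V : Type*} [Finite V] {G : SimpleGraph V} {D : Set V} {k : ℕ}
    (hD : IsMinimalDominating G D) (hk : D.ncard = k)
    (hle : ∀ D' : Set V, IsMinimalDominating G D' → D'.ncard ≤ k) :
    upperDominationNumber G = k := by
  have h := isGreatest_upperDominationNumber G
  refine le_antisymm ?_ (h.2 ⟨D, hD, hk⟩)
  obtain ⟨D', hD', hk'⟩ := h.1
  exact hk' ▸ hle D' hD'

/-! ### The rook graph -/

lemma rookGraph_adj {n : ℕ} {x y : Fin 2 × Fin n} :
    (rookGraph n).Adj x y ↔ x.1 ≠ y.1 ∧ x.2 = y.2 ∨ x.2 ≠ y.2 ∧ x.1 = y.1 := by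
  simp [rookGraph, SimpleGraph.boxProd_adj]

lemma upperDominationNumber_rookGraph {n : ℕ} (hn : 2 ≤ n) :
    upperDominationNumber (rookGraph n) = n := by
  have hinj : Function.Injective fun i : Fin n => ((0 : Fin 2), i) := fun i j h => by
    simpa using h
  refine upperDominationNumber_eq (D := Set.range fun i : Fin n => ((0 : Fin 2), i)) ?_ ?_ ?_
  · refine isMinimalDominating_of_exists_private ?_ ?_
    · rintro ⟨a, i⟩
      by_cases ha : a = 0
      · exact .inl ⟨i, by rw [ha]⟩
      · exact .inr ⟨_, ⟨i, rfl⟩, rookGraph_adj.2 (.inl ⟨Ne.symm ha, rfl⟩)⟩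
    · rintro _ ⟨i, rfl⟩
      refine ⟨(1, i), ?_⟩
      rintro _ ⟨j, rfl⟩ hij
      simp [rookGraph_adj] at hij ⊢
      exact hij
  · rw [← Set.image_univ, Set.ncard_image_of_injective _ hinj, Set.ncard_univ, Nat.card_fin]
  · intro D hD
    choose! f hf hf' using fun v (hv : v ∈ D) => hD.exists_private hv
    have hfinj : Set.InjOn f D := by
      intro u hu v hv huv
      by_contra hne
      have := hf' u hu v hv (Ne.symm hne)
      rw [huv] at this
      rcases hf v hv with h | h
      · exact this.1 h
      · exact this.2 h
    -- If the private vertices all lie in one row, they number at most `n`. Otherwise each row contains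
    -- one, and hence at most one element of `D`.
    by_cases hc : ∃ a, ∀ v ∈ D, (f v).1 = a
    · obtain ⟨a, ha⟩ := hc
      have : D.ncard ≤ (Set.univ : Set (Fin n)).ncard := by
        refine Set.ncard_le_ncard_of_injOn (fun v => (f v).2) (fun _ _ => Set.mem_univ _) ?_
        intro u hu v hv huv
        exact hfinj hu hv (Prod.ext ((ha u hu).trans (ha v hv).symm) huv)
      simpa [Set.ncard_univ] using this
    · have hrow : ∀ a, ∃ v ∈ D, (f v).1 = a := by
        intro a
        by_contra! h
        refine hc ⟨1 - a, fun v hv => ?_⟩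
        have := h v hv
        omega
      have : D.ncard ≤ (Set.univ : Set (Fin 2)).ncard := by
        refine Set.ncard_le_ncard_of_injOn Prod.fst (fun _ _ => Set.mem_univ _) ?_
        intro u hu v hv huv
        obtain ⟨w, hw, hwu⟩ := hrow u.1
        have key : ∀ x ∈ D, x.1 = u.1 → x = w := by
          intro x hx hxu
          by_contra hne
          have := hf' w hw x hx hne
          rw [rookGraph_adj] at this
          have e : x.1 = (f w).1 := hxu.trans hwu.symm
          exact this.2 (.inr ⟨fun e' => this.1 (Prod.ext e e'), e⟩)
        exact (key u hu rfl).trans (key v hv huv.symm).symm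
      rw [Set.ncard_univ, Nat.card_fin] at this
      omega

/-! ### The product of two rook graphs -/

/-- The part of `D` in the quadrant `(a, b)`, as a set of cells of the `n × n` grid. -/
noncomputable def quadrant {n : ℕ} (D : Set ((Fin 2 × Fin n) × (Fin 2 × Fin n))) (a b : Fin 2) :
    Finset (Fin n × Fin n) :=
  open Classical in {p | ((a, p.1), (b, p.2)) ∈ D}

lemma mem_quadrant {n : ℕ} {D : Set ((Fin 2 × Fin n) × (Fin 2 × Fin n))} {a b : Fin 2}
    {p : Fin n × Fin n} : p ∈ quadrant D a b ↔ ((a, p.1), (b, p.2)) ∈ D := by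
  simp [quadrant]

lemma hasPrivate_quadrant {n : ℕ} {D : Set ((Fin 2 × Fin n) × (Fin 2 × Fin n))}
    (hD : IsMinimalDominating (directProd (rookGraph n) (rookGraph n)) D) {a a' b b' : Fin 2}
    (ha : a ≠ a') (hb : b ≠ b') :
    HasPrivate (quadrant D a b) (quadrant D a' b) (quadrant D a b') (quadrant D a' b') := by
  intro v hv
  obtain ⟨⟨⟨c, i⟩, ⟨d, j⟩⟩, h1, h2⟩ := hD.exists_private (mem_quadrant.1 hv)
  have hc : c = a ∨ c = a' := by omega
  have hd : d = b ∨ d = b' := by omega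
  obtain ⟨k, l⟩ := v
  have adj : ∀ x y, (directProd (rookGraph n) (rookGraph n)).Adj x y ↔
      (rookGraph n).Adj x.1 y.1 ∧ (rookGraph n).Adj x.2 y.2 := fun _ _ => Iff.rfl
  simp only [adj, rookGraph_adj, Prod.mk.injEq, Prod.forall, ne_eq] at h1 h2
  have q1 := fun p : Fin n × Fin n => h2 a p.1 b p.2
  have q2 := fun p : Fin n × Fin n => h2 a' p.1 b p.2
  have q3 := fun p : Fin n × Fin n => h2 a p.1 b' p.2
  have q4 := fun p : Fin n × Fin n => h2 a' p.1 b' p.2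
  have ha' := ha.symm
  have hb' := hb.symm
  rcases hc with rfl | rfl <;> rcases hd with rfl | rfl
  · refine .inl ⟨(i, j), ?_⟩
    simp only [mem_quadrant, Prod.ext_iff, Prod.forall] at *
    grind
  · refine .inr (.inr (.inl ⟨(i, j), ?_⟩))
    simp only [mem_quadrant, Prod.ext_iff, Prod.forall] at *
    grind
  · refine .inr (.inl ⟨(i, j), ?_⟩)
    simp only [mem_quadrant, Prod.ext_iff, Prod.forall] at *
    grind
  · refine .inr (.inr (.inr ?_))
    simp only [IsOppPrivate, mem_quadrant, Prod.ext_iff, Prod.forall] at *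
    grind

lemma ncard_eq_quadrants {n : ℕ} (D : Set ((Fin 2 × Fin n) × (Fin 2 × Fin n))) :
    D.ncard = #(quadrant D 0 0) + #(quadrant D 1 0) + #(quadrant D 0 1) + #(quadrant D 1 1) := by
  classical
  have h : ∀ a b, #{x ∈ D.toFinset | (x.1.1, x.2.1) = (a, b)} = #(quadrant D a b) := by
    intro a b
    refine card_bij' (fun x _ => (x.1.2, x.2.2)) (fun p _ => ((a, p.1), (b, p.2))) ?_ ?_ ?_ ?_
    · rintro ⟨⟨c, i⟩, ⟨d, j⟩⟩ hx
      simp only [mem_filter, Set.mem_toFinset, Prod.mk.injEq] at hx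
      obtain ⟨hx, rfl, rfl⟩ := hx
      exact mem_quadrant.2 hx
    · intro p hp
      simpa using mem_quadrant.1 hp
    · rintro ⟨⟨c, i⟩, ⟨d, j⟩⟩ hx
      simp only [mem_filter, Set.mem_toFinset, Prod.mk.injEq] at hx
      obtain ⟨hx, rfl, rfl⟩ := hx
      rfl
    · intro p hp
      rfl
  rw [Set.ncard_eq_toFinset_card', card_eq_sum_card_fiberwise (f := fun x => (x.1.1, x.2.1))
    (t := univ) (by simp), Fintype.sum_prod_type, Fin.sum_univ_two, Fin.sum_univ_two,
    Fin.sum_univ_two, h, h, h, h]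
  omega

lemma IsMinimalDominating.ncard_le_sq {n : ℕ} (hn : 71 ≤ n)
    {D : Set ((Fin 2 × Fin n) × (Fin 2 × Fin n))}
    (hD : IsMinimalDominating (directProd (rookGraph n) (rookGraph n)) D) : D.ncard ≤ n ^ 2 := by
  have h01 : (0 : Fin 2) ≠ 1 := by decide
  rw [ncard_eq_quadrants]
  exact IsPrivateConfig.card_le hn ⟨hasPrivate_quadrant hD h01 h01,
    hasPrivate_quadrant hD h01.symm h01, hasPrivate_quadrant hD h01 h01.symm,
    hasPrivate_quadrant hD h01.symm h01.symm⟩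

lemma upperDominationNumber_directProd_rookGraph {n : ℕ} (hn : 71 ≤ n) :
    upperDominationNumber (directProd (rookGraph n) (rookGraph n)) = n ^ 2 := by
  have hinj : Function.Injective fun p : Fin n × Fin n => (((0 : Fin 2), p.1), ((0 : Fin 2), p.2)) :=
    fun p q h => by
      simp only [Prod.mk.injEq, true_and] at h
      exact Prod.ext h.1 h.2
  refine upperDominationNumber_eq
    (D := Set.range fun p : Fin n × Fin n => (((0 : Fin 2), p.1), ((0 : Fin 2), p.2))) ?_ ?_
    fun D hD => hD.ncard_le_sq hn
  · refine isMinimalDominating_of_exists_private ?_ ?_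
    · have hnt : Nontrivial (Fin n) := Fin.nontrivial_iff_two_le.2 (by omega)
      -- Every vertex of the rook graph, in the row `0` or not, has a neighbour in that row.
      have htot : ∀ x : Fin 2 × Fin n, ∃ i, (rookGraph n).Adj (0, i) x := by
        rintro ⟨a, i⟩
        by_cases ha : a = 0
        · obtain ⟨k, hk⟩ := exists_ne i
          exact ⟨k, rookGraph_adj.2 (.inr ⟨hk, ha.symm⟩)⟩
        · exact ⟨i, rookGraph_adj.2 (.inl ⟨Ne.symm ha, rfl⟩)⟩
      rintro ⟨x, y⟩
      obtain ⟨i, hi⟩ := htot x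
      obtain ⟨j, hj⟩ := htot y
      exact .inr ⟨_, ⟨(i, j), rfl⟩, hi, hj⟩
    · rintro _ ⟨⟨i, j⟩, rfl⟩
      refine ⟨((1, i), (1, j)), ?_⟩
      rintro _ ⟨⟨k, l⟩, rfl⟩ hne
      refine ⟨by simp, fun h => hne ?_⟩
      have h1 := rookGraph_adj.1 h.1
      have h2 := rookGraph_adj.1 h.2
      simp at h1 h2
      simp [h1, h2]
  · rw [← Set.image_univ, Set.ncard_image_of_injective _ hinj, Set.ncard_univ, Nat.card_prod,
      Nat.card_fin, sq]

end UpperDomination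

theorem mainTheorem2 (n : ℕ) (hn : 71 ≤ n) :
    UpperDomination.upperDominationNumber
        (UpperDomination.directProd (UpperDomination.rookGraph n) (UpperDomination.rookGraph n))
      = n ^ 2 ∧
    n ^ 2 = (UpperDomination.upperDominationNumber (UpperDomination.rookGraph n)) ^ 2 := by
  rw [UpperDomination.upperDominationNumber_rookGraph (by omega)]
  exact ⟨UpperDomination.upperDominationNumber_directProd_rookGraph hn, rfl⟩
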